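/- Let $\mathbb{F}$ be a skew field, let $\mathbb{F}[t]$ be the polynomial ring over $\mathbb{F}$ in an indeterminate $t$ that commutes with all elements of $\mathbb{F}$, and let $\mathbb{F}(t)$ be its skew field of (Ore) fractions $p/q$, with $\deg(p/q) := \deg p - \deg q$ for $p,q \neq 0$. Every nonsingular square matrix $B$ over $\mathbb{F}(t)$ can be written as $B = LDPU$ with $L$ lower unitriangular, $D = \mathrm{diag}(d_1,\dots,d_n)$ with nonzero $d_i$, $P$ a permutation matrix and $U$ upper unitriangular, where $DP$ is unique. The Dieudonné determinant of $B$ is the class $\operatorname{Det} B := \operatorname{sgn}(P)\, d_1 d_2\cdots d_n$ in the abelianization $\mathbb{F}(t)^\times/[\mathbb{F}(t)^\times,\mathbb{F}(t)^\times]$; its degree is well defined, since $\deg$ is zero on commutators. If $B$ is singular, put $\deg\operatorname{Det} B := -\infty$. Let $A$ be an $n\times m$ matrix over $\mathbb{F}(t)$. For $X \subseteq \{1,\dots,m\}$ let $A[X]$ denote the submatrix of $A$ consisting of the columns with index in $X$, and define $\omega_A : 2^{\{1,\dots,m\}} \to \mathbb{R}\cup\{-\infty\}$ by $\omega_A(X)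 := \deg\operatorname{Det} A[X]$ if $|X| = n$, and $\omega_A(X) := -\infty$ otherwise. Then $\omega_A$ is a valuated matroid, that is: for all $X, Y \subseteq \{1,\dots,m\}$ with $\omega_A(X), \omega_A(Y) \neq -\infty$ and every $e \in X\setminus Y$ there is $f \in Y \setminus X$ such that $$\omega_A(X) + \omega_A(Y) \le \omega_A\big((X\cup\{f\})\setminus\{e\}\big) + \omega_A\big((Y\cup\{e\})\setminus\{f\}\big).$$ -/

import Mathlib

namespace DegDet

/-! ### The skew field of rational functions over a skew field -/

section RationalFunctions

variable {F : Type*} [DivisionRing F]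

/-- Two polynomials over a skew field (with central indeterminate) have a nontrivial common left
multiple. -/
theorem exists_common_left_multiple (p q : Polynomial F) :
    ∃ a b : Polynomial F, (a ≠ 0 ∨ b ≠ 0) ∧ a * p = b * q := by
  suffices H : ∀ (N : ℕ) (p q : Polynomial F), p.natDegree + q.natDegree < N →
      ∃ a b : Polynomial F, (a ≠ 0 ∨ b ≠ 0) ∧ a * p = b * q from
    H _ p q (Nat.lt_succ_self _)
  intro N
  induction N with
  | zero => intro p q h; omega
  | succ N ih =>
    have key : ∀ p q : Polynomial F, p.natDegree + q.natDegree < N + 1 →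
        q.natDegree ≤ p.natDegree →
        ∃ a b : Polynomial F, (a ≠ 0 ∨ b ≠ 0) ∧ a * p = b * q := by
      intro p q h hqp
      by_cases hp : p = 0
      · exact ⟨1, 0, Or.inl one_ne_zero, by simp [hp]⟩
      by_cases hq : q = 0
      · exact ⟨0, 1, Or.inr one_ne_zero, by simp [hq]⟩
      obtain ⟨c, hc⟩ : ∃ c : Polynomial F, c = Polynomial.C (p.leadingCoeff * q.leadingCoeff⁻¹) *
        Polynomial.X ^ (p.natDegree - q.natDegree) := ⟨_, rfl⟩
      have hlq : q.leadingCoeff ≠ 0 := Polynomial.leadingCoeff_ne_zero.mpr hq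
      have hlp : p.leadingCoeff ≠ 0 := Polynomial.leadingCoeff_ne_zero.mpr hp
      have hc0 : p.leadingCoeff * q.leadingCoeff⁻¹ ≠ 0 := mul_ne_zero hlp (inv_ne_zero hlq)
      have hcne : c ≠ 0 := by
        rw [← Polynomial.leadingCoeff_ne_zero, hc, Polynomial.leadingCoeff_C_mul_X_pow]
        exact hc0
      have hdc : c.natDegree = p.natDegree - q.natDegree := by
        rw [hc, Polynomial.natDegree_C_mul_X_pow _ _ hc0]
      have hlc : c.leadingCoeff = p.leadingCoeff * q.leadingCoeff⁻¹ := by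
        rw [hc, Polynomial.leadingCoeff_C_mul_X_pow]
      have hcq : c * q ≠ 0 := mul_ne_zero hcne hq
      have hdeg : p.degree = (c * q).degree := by
        rw [Polynomial.degree_eq_natDegree hp, Polynomial.degree_eq_natDegree hcq,
          Polynomial.natDegree_mul hcne hq, hdc, Nat.sub_add_cancel hqp]
      have hlead : p.leadingCoeff = (c * q).leadingCoeff := by
        rw [Polynomial.leadingCoeff_mul, hlc, mul_assoc, inv_mul_cancel₀ hlq, mul_one]
      have hlt := Polynomial.degree_sub_lt_left hdeg hp hlead
      by_cases hr : p - c * q = 0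
      · exact ⟨1, c, Or.inl one_ne_zero, by rw [one_mul]; exact sub_eq_zero.mp hr⟩
      have hlt' : (p - c * q).natDegree < p.natDegree :=
        Polynomial.natDegree_lt_natDegree hr hlt
      obtain ⟨a, b, hab, h'⟩ := ih (p - c * q) q (by omega)
      refine ⟨a, b + a * c, ?_, ?_⟩
      · by_cases ha : a = 0
        · right
          simpa [ha] using hab
        · exact Or.inl ha
      · rw [add_mul, ← h', mul_sub, mul_assoc, sub_add_cancel]
    intro p q h
    rcases le_total q.natDegree p.natDegree with hqp | hpq
    · exact key p q h hqp
    · obtain ⟨a, b, hab, h'⟩ := key q p (by omega) hpq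
      exact ⟨b, a, hab.symm, h'.symm⟩

/-- The polynomial ring over a skew field is an Ore domain. -/
theorem nonempty_oreSet : Nonempty (OreLocalization.OreSet (nonZeroDivisors (Polynomial F))) := by
  rw [OreLocalization.nonempty_oreSet_iff_of_noZeroDivisors]
  intro p q
  have hq : (q : Polynomial F) ≠ 0 := nonZeroDivisors.coe_ne_zero q
  obtain ⟨a, b, hab, h⟩ := exists_common_left_multiple p (q : Polynomial F)
  have ha : a ≠ 0 := by
    rintro rfl
    rw [zero_mul] at h
    rcases mul_eq_zero.mp h.symm with hb | hb
    · simp [hb] at hab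
    · exact hq hb
  exact ⟨b, ⟨a, mem_nonZeroDivisors_of_ne_zero ha⟩, h⟩

noncomputable instance instOreSet :
    OreLocalization.OreSet (nonZeroDivisors (Polynomial F)) :=
  Classical.choice nonempty_oreSet

end RationalFunctions

/-- The skew field `F(t)` of rational functions over a skew field `F`: the Ore quotient ring of the
polynomial ring `F[t]`, whose indeterminate commutes with all coefficients. It is a skew field by
Mathlib's instance for Ore localizations. Mathlib writes its elements as left fractions
`p /ₒ q = q⁻¹ * p`; every element is also a right fraction `p * q⁻¹`, see
`exists_right_fraction`. -/
abbrev RationalFunction (F : Type*) [DivisionRing F] : Type _ :=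
  OreLocalization (nonZeroDivisors (Polynomial F)) (Polynomial F)

section Degree

variable {F : Type*} [DivisionRing F]

open scoped Classical in
/-- The degree of a rational function: `deg 0 = -∞`, and the degree of a fraction of `p ≠ 0` by `q`
is `deg p - deg q`. -/
noncomputable def deg : RationalFunction F → WithBot ℤ :=
  OreLocalization.liftExpand
    (fun p q => if p = 0 then ⊥ else
      (((p.natDegree : ℤ) - ((q : Polynomial F).natDegree : ℤ) : ℤ) : WithBot ℤ))
    (by
      intro p a q ha
      have h := nonZeroDivisors.coe_ne_zero (⟨a * q, ha⟩ : nonZeroDivisors (Polynomial F))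
      have ha0 : a ≠ 0 := left_ne_zero_of_mul h
      have hq0 : (q : Polynomial F) ≠ 0 := right_ne_zero_of_mul h
      by_cases hp : p = 0
      · simp [hp]
      · have hap : a * p ≠ 0 := mul_ne_zero ha0 hp
        simp only [smul_eq_mul, hp, hap, if_false, Polynomial.natDegree_mul ha0 hp,
          Polynomial.natDegree_mul ha0 hq0]
        congr 1
        push_cast
        ring)

theorem deg_oreDiv (p : Polynomial F) (q : nonZeroDivisors (Polynomial F)) (hp : p ≠ 0) :
    deg (OreLocalization.oreDiv p q) =
      (((p.natDegree : ℤ) - ((q : Polynomial F).natDegree : ℤ) : ℤ) : WithBot ℤ) := by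
  rw [deg, OreLocalization.liftExpand_of, if_neg hp]

theorem deg_zero : deg (0 : RationalFunction F) = ⊥ := by
  rw [OreLocalization.zero_def, deg, OreLocalization.liftExpand_of, if_pos rfl]

theorem deg_one : deg (1 : RationalFunction F) = 0 := by
  rw [OreLocalization.one_def, deg_oreDiv _ _ one_ne_zero]
  simp

theorem deg_mul (x y : RationalFunction F) : deg (x * y) = deg x + deg y := by
  by_cases hx : x = 0
  · simp [hx, deg_zero]
  by_cases hy : y = 0
  · simp [hy, deg_zero]
  induction x using OreLocalization.ind with | _ p q
  induction y using OreLocalization.ind with | _ p' q'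
  have hp : p ≠ 0 := by rintro rfl; simp at hx
  have hp' : p' ≠ 0 := by rintro rfl; simp at hy
  have hq := nonZeroDivisors.coe_ne_zero q
  have hq' := nonZeroDivisors.coe_ne_zero q'
  obtain ⟨u, v, huv⟩ : ∃ (u : Polynomial F) (v : nonZeroDivisors (Polynomial F)),
      (v : Polynomial F) * p = u * (q' : Polynomial F) :=
    ⟨_, _, OreLocalization.ore_eq p q'⟩
  have hv := nonZeroDivisors.coe_ne_zero v
  have hu : u ≠ 0 := by
    rintro rfl
    rw [zero_mul] at huv
    exact (mul_ne_zero hv hp) huv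
  rw [OreLocalization.oreDiv_mul_char p p' q q' u v huv, deg_oreDiv _ _ (mul_ne_zero hu hp'),
    deg_oreDiv _ _ hp, deg_oreDiv _ _ hp', ← WithBot.coe_add]
  have h := congrArg Polynomial.natDegree huv
  rw [Polynomial.natDegree_mul hv hp, Polynomial.natDegree_mul hu hq'] at h
  have h2 : ((v * q : nonZeroDivisors (Polynomial F)) : Polynomial F).natDegree =
      (v : Polynomial F).natDegree + (q : Polynomial F).natDegree := by
    rw [Submonoid.coe_mul, Polynomial.natDegree_mul hv hq]
  rw [h2, Polynomial.natDegree_mul hu hp']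
  congr 1
  push_cast
  have h' : ((v : Polynomial F).natDegree : ℤ) + p.natDegree =
    u.natDegree + (q' : Polynomial F).natDegree := by exact_mod_cast h
  linarith

/-- Every rational function is a right fraction `p * q⁻¹` of polynomials. -/
theorem exists_right_fraction (x : RationalFunction F) : ∃ p q : Polynomial F, q ≠ 0 ∧
    x = OreLocalization.numeratorHom p * (OreLocalization.numeratorHom q)⁻¹ := by
  induction x using OreLocalization.ind with | _ r s
  have hs := nonZeroDivisors.coe_ne_zero s
  obtain ⟨a, b, hab, h⟩ := exists_common_left_multiple (F := Fᵐᵒᵖ)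
    (Polynomial.opRingEquiv F (MulOpposite.op r))
    (Polynomial.opRingEquiv F (MulOpposite.op (s : Polynomial F)))
  obtain ⟨q, rfl⟩ : ∃ q, a = Polynomial.opRingEquiv F (MulOpposite.op q) :=
    ⟨((Polynomial.opRingEquiv F).symm a).unop, by simp⟩
  obtain ⟨p, rfl⟩ : ∃ p, b = Polynomial.opRingEquiv F (MulOpposite.op p) :=
    ⟨((Polynomial.opRingEquiv F).symm b).unop, by simp⟩
  rw [← map_mul, ← map_mul, ← MulOpposite.op_mul, ← MulOpposite.op_mul] at h
  have h' : r * q = s * p := MulOpposite.op_injective ((Polynomial.opRingEquiv F).injective h)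
  have hq : q ≠ 0 := by
    rintro rfl
    rw [mul_zero] at h'
    rcases mul_eq_zero.mp h'.symm with h0 | h0
    · exact hs h0
    · simp [h0] at hab
  refine ⟨p, q, hq, ?_⟩
  have hq' : (OreLocalization.numeratorHom q : RationalFunction F) ≠ 0 :=
    (OreLocalization.numerator_isUnit
      (⟨q, mem_nonZeroDivisors_of_ne_zero hq⟩ : nonZeroDivisors (Polynomial F))).ne_zero
  rw [eq_mul_inv_iff_mul_eq₀ hq', OreLocalization.numeratorHom_apply,
    OreLocalization.numeratorHom_apply, OreLocalization.mul_div_one, h',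
    ← OreLocalization.mul_div_one, OreLocalization.div_eq_one, one_mul]

/-- The degree of a right fraction `p * q⁻¹` is `deg p - deg q` as well. -/
theorem deg_mul_inv (p q : Polynomial F) (hp : p ≠ 0) (hq : q ≠ 0) :
    deg (OreLocalization.numeratorHom p * (OreLocalization.numeratorHom q)⁻¹ :
      RationalFunction F) = (((p.natDegree : ℤ) - (q.natDegree : ℤ) : ℤ) : WithBot ℤ) := by
  rw [deg_mul, OreLocalization.numeratorHom_apply, OreLocalization.numeratorHom_apply,
    OreLocalization.inv_def, dif_neg hq, deg_oreDiv _ _ hp, deg_oreDiv _ _ (by simp),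
    ← WithBot.coe_add]
  simp [sub_eq_add_neg]

theorem deg_ne_bot {x : RationalFunction F} (hx : x ≠ 0) : deg x ≠ ⊥ := by
  intro h
  have h1 := deg_mul x x⁻¹
  rw [mul_inv_cancel₀ hx, deg_one, h, WithBot.bot_add] at h1
  exact absurd h1 (by simp)

/-- The degree as a homomorphism from the multiplicative group of `F(t)` to `ℤ`. -/
noncomputable def degHom : (RationalFunction F)ˣ →* Multiplicative ℤ where
  toFun u := Multiplicative.ofAdd ((deg (u : RationalFunction F)).unbot (deg_ne_bot u.ne_zero))
  map_one' := by
    rw [← ofAdd_zero]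
    congr 1
    rw [WithBot.unbot_eq_iff]
    exact deg_one
  map_mul' u v := by
    rw [← ofAdd_add]
    congr 1
    rw [WithBot.unbot_eq_iff, WithBot.coe_add, WithBot.coe_unbot, WithBot.coe_unbot, Units.val_mul,
      deg_mul]

/-- The degree on the abelianization of the multiplicative group of `F(t)`. It is well defined, as
the degree is zero on commutators. -/
noncomputable def degAb : Abelianization (RationalFunction F)ˣ →* Multiplicative ℤ :=
  Abelianization.lift degHom

end Degree

/-! ### The Dieudonné determinant -/

section Dieudonne

variable {K : Type*} [DivisionRing K] {n : ℕ}

/-- Lower triangular with ones on the diagonal. -/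
def IsLowerUnitriangular (L : Matrix (Fin n) (Fin n) K) : Prop :=
  (∀ i, L i i = 1) ∧ ∀ i j, i < j → L i j = 0

/-- Upper triangular with ones on the diagonal. -/
def IsUpperUnitriangular (U : Matrix (Fin n) (Fin n) K) : Prop :=
  (∀ i, U i i = 1) ∧ ∀ i j, j < i → U i j = 0

/-- `A = L D P U` is a Bruhat normal form of the nonsingular matrix `A`, with `L` lower
unitriangular, `D` the diagonal matrix of the nonzero elements `d i`, `P` the permutation matrix of
`σ`, and `U` upper unitriangular. -/
structure IsBruhatForm (A L : Matrix (Fin n) (Fin n) K) (d : Fin n → Kˣ)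
    (σ : Equiv.Perm (Fin n)) (U : Matrix (Fin n) (Fin n) K) : Prop where
  lower : IsLowerUnitriangular L
  upper : IsUpperUnitriangular U
  eq : A = L * Matrix.diagonal (fun i => (d i : K)) * σ.permMatrix K * U

theorem IsLowerUnitriangular.mul {L M : Matrix (Fin n) (Fin n) K} (hL : IsLowerUnitriangular L)
    (hM : IsLowerUnitriangular M) : IsLowerUnitriangular (L * M) := by
  constructor
  · intro i
    rw [Matrix.mul_apply, Finset.sum_eq_single i, hL.1, hM.1, one_mul]
    · intro k _ hk
      rcases lt_or_gt_of_ne hk with h | h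
      · rw [hM.2 k i h, mul_zero]
      · rw [hL.2 i k h, zero_mul]
    · simp
  · intro i j hij
    rw [Matrix.mul_apply]
    refine Finset.sum_eq_zero fun k _ => ?_
    rcases lt_or_ge i k with h | h
    · rw [hL.2 i k h, zero_mul]
    · rw [hM.2 k j (lt_of_le_of_lt h hij), mul_zero]

theorem IsUpperUnitriangular.mul {U V : Matrix (Fin n) (Fin n) K} (hU : IsUpperUnitriangular U)
    (hV : IsUpperUnitriangular V) : IsUpperUnitriangular (U * V) := by
  constructor
  · intro i
    rw [Matrix.mul_apply, Finset.sum_eq_single i, hU.1, hV.1, one_mul]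
    · intro k _ hk
      rcases lt_or_gt_of_ne hk with h | h
      · rw [hU.2 i k h, zero_mul]
      · rw [hV.2 k i h, mul_zero]
    · simp
  · intro i j hij
    rw [Matrix.mul_apply]
    refine Finset.sum_eq_zero fun k _ => ?_
    rcases lt_or_ge k i with h | h
    · rw [hU.2 i k h, zero_mul]
    · rw [hV.2 k j (lt_of_lt_of_le hij h), mul_zero]

/-- Gaussian elimination: the first `k` rows can be reduced to one nonzero entry each, which is also
the only nonzero entry of its column. -/
theorem exists_reduction (A : Matrix (Fin n) (Fin n) K) (hA : IsUnit A) (k : ℕ) (hk : k ≤ n) :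
    ∃ L B U : Matrix (Fin n) (Fin n) K, IsLowerUnitriangular L ∧ IsUpperUnitriangular U ∧
      IsUnit B ∧ A = L * B * U ∧
      ∀ i : Fin n, (i : ℕ) < k → ∃ j, B i j ≠ 0 ∧ (∀ j', j' ≠ j → B i j' = 0) ∧
        ∀ i', i' ≠ i → B i' j = 0 := by
  induction k with
  | zero =>
    refine ⟨1, A, 1, ⟨?_, ?_⟩, ⟨?_, ?_⟩, hA, by simp, by simp⟩
    · simp
    · intro i j h; exact Matrix.one_apply_ne h.ne
    · simp
    · intro i j h; exact Matrix.one_apply_ne h.ne'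
  | succ k ih =>
    obtain ⟨L, B, U, hL, hU, hB, hAB, hred⟩ := ih (by omega)
    set r : Fin n := ⟨k, by omega⟩ with hr
    -- the pivot of row `r`: its first nonzero entry
    have hrow : ∃ j, B r j ≠ 0 := by
      by_contra hcon
      push Not at hcon
      obtain ⟨C, hC⟩ := hB.exists_right_inv
      have h1 := congrFun (congrFun hC r) r
      rw [Matrix.mul_apply, Finset.sum_eq_zero, Matrix.one_apply_eq] at h1
      · exact zero_ne_one h1
      · intro j _
        rw [hcon j, zero_mul]
    obtain ⟨c, hc, hmin⟩ : ∃ c, B r c ≠ 0 ∧ ∀ j, j < c → B r j = 0 := by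
      classical
      have hne : (Finset.univ.filter fun j => B r j ≠ 0).Nonempty := by
        obtain ⟨j, hj⟩ := hrow
        exact ⟨j, by simpa using hj⟩
      refine ⟨_, (Finset.mem_filter.mp (Finset.min'_mem _ hne)).2, fun j hj => ?_⟩
      by_contra h
      exact absurd (Finset.min'_le _ j (by simpa using h)) (not_le.mpr hj)
    let N : Matrix (Fin n) (Fin n) K :=
      Matrix.of fun i j => if j = r ∧ r < i then B i c * (B r c)⁻¹ else 0
    let M : Matrix (Fin n) (Fin n) K :=
      Matrix.of fun i j => if i = c ∧ c < j then (B r c)⁻¹ * B r j else 0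
    have hNapp : ∀ i j, N i j = if j = r ∧ r < i then B i c * (B r c)⁻¹ else 0 := fun _ _ => rfl
    have hMapp : ∀ i j, M i j = if i = c ∧ c < j then (B r c)⁻¹ * B r j else 0 := fun _ _ => rfl
    have hNmul : ∀ (X : Matrix (Fin n) (Fin n) K) i j, (N * X) i j = N i r * X r j := by
      intro X i j
      rw [Matrix.mul_apply, Finset.sum_eq_single r]
      · intro b _ hb
        rw [hNapp, if_neg (by tauto), zero_mul]
      · simp
    have hMmul : ∀ (X : Matrix (Fin n) (Fin n) K) i j, (X * M) i j = X i c * M c j := by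
      intro X i j
      rw [Matrix.mul_apply, Finset.sum_eq_single c]
      · intro b _ hb
        rw [hMapp, if_neg (by tauto), mul_zero]
      · simp
    have hNN : N * N = 0 := by
      ext i j
      rw [hNmul, hNapp r j, if_neg (by simp), mul_zero, Matrix.zero_apply]
    have hMM : M * M = 0 := by
      ext i j
      rw [hMmul, hMapp i c, if_neg (by simp), zero_mul, Matrix.zero_apply]
    have hN1 : (1 + N) * (1 - N) = 1 := by
      rw [add_mul, mul_sub, mul_sub, hNN]; simp
    have hN2 : (1 - N) * (1 + N) = 1 := by
      rw [sub_mul, mul_add, mul_add, hNN]; simp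
    have hM1 : (1 + M) * (1 - M) = 1 := by
      rw [add_mul, mul_sub, mul_sub, hMM]; simp
    have hM2 : (1 - M) * (1 + M) = 1 := by
      rw [sub_mul, mul_add, mul_add, hMM]; simp
    have hNu : IsUnit (1 - N) := ⟨⟨_, _, hN2, hN1⟩, rfl⟩
    have hMu : IsUnit (1 - M) := ⟨⟨_, _, hM2, hM1⟩, rfl⟩
    have hNl : IsLowerUnitriangular (1 + N) := by
      constructor
      · intro i
        rw [Matrix.add_apply, Matrix.one_apply_eq, hNapp, if_neg, add_zero]
        rintro ⟨rfl, h⟩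
        exact lt_irrefl _ h
      · intro i j hij
        rw [Matrix.add_apply, Matrix.one_apply_ne hij.ne, hNapp, if_neg, add_zero]
        rintro ⟨rfl, h⟩
        exact lt_asymm h hij
    have hMup : IsUpperUnitriangular (1 + M) := by
      constructor
      · intro i
        rw [Matrix.add_apply, Matrix.one_apply_eq, hMapp, if_neg, add_zero]
        rintro ⟨rfl, h⟩
        exact lt_irrefl _ h
      · intro i j hij
        rw [Matrix.add_apply, Matrix.one_apply_ne hij.ne', hMapp, if_neg, add_zero]
        rintro ⟨rfl, h⟩
        exact lt_asymm h hij
    -- entries of the reduced matrix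
    have hB1 : ∀ i j, ((1 - N) * B) i j = B i j - N i r * B r j := by
      intro i j
      rw [sub_mul, one_mul, Matrix.sub_apply, hNmul]
    have hB2 : ∀ i j, ((1 - N) * B * (1 - M)) i j =
        (B i j - N i r * B r j) - (B i c - N i r * B r c) * M c j := by
      intro i j
      rw [mul_sub, mul_one, Matrix.sub_apply, hMmul, hB1, hB1]
    -- columns used by earlier rows vanish in row `r`; earlier rows vanish in column `c`
    have hcol : ∀ i : Fin n, (i : ℕ) < k → B i c = 0 := by
      intro i hi
      obtain ⟨j, _, hj2, hj3⟩ := hred i hi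
      apply hj2
      rintro rfl
      exact hc (hj3 r (by intro h; rw [← h] at hi; simp [hr] at hi))
    refine ⟨L * (1 + N), (1 - N) * B * (1 - M), (1 + M) * U, hL.mul hNl, hMup.mul hU,
      (hNu.mul hB).mul hMu, ?_, ?_⟩
    · rw [hAB]
      calc L * B * U = L * 1 * B * 1 * U := by simp
        _ = L * ((1 + N) * (1 - N)) * B * ((1 - M) * (1 + M)) * U := by rw [hN1, hM2]
        _ = _ := by simp only [Matrix.mul_assoc]
    · intro i hi
      have hNr : N r r = 0 := by rw [hNapp, if_neg (by simp)]
      have hMc : M c c = 0 := by rw [hMapp, if_neg (by simp)]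
      rcases Nat.lt_succ_iff_lt_or_eq.mp hi with hik | hik
      · obtain ⟨j, hj1, hj2, hj3⟩ := hred i hik
        have hir : i < r := hik
        have hNi : N i r = 0 := by
          rw [hNapp, if_neg]
          rintro ⟨_, h⟩
          exact lt_asymm h hir
        have hrj : B r j = 0 := hj3 r hir.ne'
        have hMj : M c j = 0 := by
          rw [hMapp]
          split_ifs
          · rw [hrj, mul_zero]
          · rfl
        refine ⟨j, ?_, ?_, ?_⟩
        · rw [hB2, hNi, hMj]
          simpa using hj1
        · intro j' hj'
          rw [hB2, hNi, hcol i hik, hj2 j' hj']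
          simp
        · intro i' hi'
          rw [hB2, hMj, hrj, hj3 i' hi']
          simp
      · obtain rfl : i = r := Fin.ext hik
        refine ⟨c, ?_, ?_, ?_⟩
        · rw [hB2, hNr, hMc]
          simpa using hc
        · intro j' hj'
          rw [hB2, hNr]
          rcases lt_or_gt_of_ne hj' with h | h
          · rw [hmin j' h, hMapp, if_neg (fun h' => lt_asymm h h'.2)]
            simp
          · rw [hMapp, if_pos ⟨rfl, h⟩, ← mul_assoc]
            simp [mul_inv_cancel₀ hc]
        · intro i' hi'
          rw [hB2, hMc]
          rcases lt_or_gt_of_ne hi' with h | h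
          · rw [hcol i' (by rw [← hik]; exact h), hNapp, if_neg (fun h' => lt_asymm h h'.2)]
            simp
          · rw [hNapp, if_pos ⟨rfl, h⟩, mul_assoc, inv_mul_cancel₀ hc]
            simp

theorem diagonal_mul_permMatrix_apply (d : Fin n → Kˣ) (σ : Equiv.Perm (Fin n)) (i j : Fin n) :
    (Matrix.diagonal (fun i => (d i : K)) * σ.permMatrix K) i j =
      if σ i = j then (d i : K) else 0 := by
  rw [Matrix.diagonal_mul, Equiv.Perm.permMatrix, PEquiv.toMatrix_apply]
  simp [eq_comm]

/-- Every nonsingular matrix over a skew field has a Bruhat normal form. -/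
theorem exists_isBruhatForm (A : Matrix (Fin n) (Fin n) K) (hA : IsUnit A) :
    ∃ L d σ U, IsBruhatForm A L d σ U := by
  obtain ⟨L, B, U, hL, hU, -, hAB, hred⟩ := exists_reduction A hA n le_rfl
  choose s hs1 hs2 hs3 using fun i : Fin n => hred i i.2
  have hinj : Function.Injective s := by
    intro i i' h
    by_contra hne
    exact hs1 i' (by rw [← h]; exact hs3 i i' (Ne.symm hne))
  let σ : Equiv.Perm (Fin n) := Equiv.ofBijective s (Finite.injective_iff_bijective.mp hinj)
  refine ⟨L, fun i => Units.mk0 (B i (s i)) (hs1 i), σ, U, hL, hU, ?_⟩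
  have hB : B = Matrix.diagonal (fun i => ((Units.mk0 (B i (s i)) (hs1 i) : Kˣ) : K)) *
      σ.permMatrix K := by
    ext i j
    rw [diagonal_mul_permMatrix_apply]
    by_cases h : j = s i
    · subst h
      simp [σ]
    · rw [hs2 i j h, if_neg (fun h' => h (by rw [← h']; rfl))]
  rw [Matrix.mul_assoc L, ← hB]
  exact hAB

theorem IsLowerUnitriangular.of_mul_eq_one {L X : Matrix (Fin n) (Fin n) K}
    (hL : IsLowerUnitriangular L) (h : L * X = 1) : IsLowerUnitriangular X := by
  have main : ∀ i j : Fin n, i ≤ j → X i j = (1 : Matrix (Fin n) (Fin n) K) i j := by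
    intro i
    induction i using WellFoundedLT.induction with
    | ind i ih =>
      intro j hij
      rw [← h, Matrix.mul_apply, Finset.sum_eq_single i, hL.1, one_mul]
      · intro k _ hk
        rcases lt_or_gt_of_ne hk with hk | hk
        · rw [ih k hk j (hk.le.trans hij), Matrix.one_apply_ne (hk.trans_le hij).ne, mul_zero]
        · rw [hL.2 i k hk, zero_mul]
      · simp
  exact ⟨fun i => by rw [main i i le_rfl, Matrix.one_apply_eq],
    fun i j hij => by rw [main i j hij.le, Matrix.one_apply_ne hij.ne]⟩

theorem IsUpperUnitriangular.of_mul_eq_one {U X : Matrix (Fin n) (Fin n) K}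
    (hU : IsUpperUnitriangular U) (h : X * U = 1) : IsUpperUnitriangular X := by
  have main : ∀ j i : Fin n, j ≤ i → X i j = (1 : Matrix (Fin n) (Fin n) K) i j := by
    intro j
    induction j using WellFoundedLT.induction with
    | ind j ih =>
      intro i hij
      rw [← h, Matrix.mul_apply, Finset.sum_eq_single j, hU.1, mul_one]
      · intro k _ hk
        rcases lt_or_gt_of_ne hk with hk | hk
        · rw [ih k hk i (hk.le.trans hij), Matrix.one_apply_ne (hk.trans_le hij).ne', zero_mul]
        · rw [hU.2 k j hk, mul_zero]
      · simp
  exact ⟨fun i => by rw [main i i le_rfl, Matrix.one_apply_eq],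
    fun i j hij => by rw [main j i hij.le, Matrix.one_apply_ne hij.ne']⟩

/-- The diagonal and the permutation of a Bruhat normal form are unique. -/
theorem IsBruhatForm.unique {A L L' U U' : Matrix (Fin n) (Fin n) K} {d d' : Fin n → Kˣ}
    {σ σ' : Equiv.Perm (Fin n)} (hA : IsUnit A) (h : IsBruhatForm A L d σ U)
    (h' : IsBruhatForm A L' d' σ' U') : d = d' ∧ σ = σ' := by
  obtain ⟨C, hC1, hC2⟩ := isUnit_iff_exists.mp hA
  obtain ⟨M, hM⟩ : ∃ M, M = Matrix.diagonal (fun i => (d i : K)) * σ.permMatrix K := ⟨_, rfl⟩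
  obtain ⟨M', hM'⟩ : ∃ M', M' = Matrix.diagonal (fun i => (d' i : K)) * σ'.permMatrix K :=
    ⟨_, rfl⟩
  have e : A = L * M * U := by rw [hM, ← Matrix.mul_assoc L]; exact h.eq
  have e' : A = L' * M' * U' := by rw [hM', ← Matrix.mul_assoc L']; exact h'.eq
  obtain ⟨X, hX⟩ : ∃ X, L' * X = 1 :=
    ⟨M' * U' * C, by rw [← hC1]; conv_rhs => rw [e']
                     simp only [Matrix.mul_assoc]⟩
  obtain ⟨Y, hY⟩ : ∃ Y, Y * U = 1 :=
    ⟨C * L * M, by rw [← hC2]; conv_rhs => rw [e]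
                   simp only [Matrix.mul_assoc]⟩
  have hX' : X * L' = 1 := mul_eq_one_symm hX
  have hY' : U * Y = 1 := mul_eq_one_symm hY
  have hLX : IsLowerUnitriangular (X * L) := (h'.lower.of_mul_eq_one hX).mul h.lower
  have hUY : IsUpperUnitriangular (U' * Y) := h'.upper.mul (h.upper.of_mul_eq_one hY)
  have key : (X * L) * M = M' * (U' * Y) := by
    calc (X * L) * M = X * (L * M * U) * Y := by
          rw [Matrix.mul_assoc X (L * M * U) Y, Matrix.mul_assoc (L * M) U Y, hY']
          simp only [Matrix.mul_assoc, Matrix.mul_one]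
      _ = (X * L') * M' * (U' * Y) := by rw [← e, e']; simp only [Matrix.mul_assoc]
      _ = _ := by rw [hX', Matrix.one_mul]
  have el : ∀ i k, ((X * L) * M) i (σ k) = (X * L) i k * (d k : K) := by
    intro i k
    rw [Matrix.mul_apply, Finset.sum_eq_single k]
    · rw [hM, diagonal_mul_permMatrix_apply, if_pos rfl]
    · intro b _ hb
      rw [hM, diagonal_mul_permMatrix_apply, if_neg (fun hh => hb (σ.injective hh)), mul_zero]
    · simp
  have er : ∀ i j, (M' * (U' * Y)) i j = (d' i : K) * (U' * Y) (σ' i) j := by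
    intro i j
    rw [Matrix.mul_apply, Finset.sum_eq_single (σ' i)]
    · rw [hM', diagonal_mul_permMatrix_apply, if_pos rfl]
    · intro b _ hb
      rw [hM', diagonal_mul_permMatrix_apply, if_neg (Ne.symm hb), zero_mul]
    · simp
  have hdiag : ∀ i, (d i : K) = (d' i : K) * (U' * Y) (σ' i) (σ i) := by
    intro i
    rw [← er, ← key, el, hLX.1, one_mul]
  have hle : ∀ i, σ' i ≤ σ i := by
    intro i
    by_contra hlt
    have := hdiag i
    rw [hUY.2 _ _ (not_le.mp hlt), mul_zero] at this
    exact (d i).ne_zero this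
  have hsum : ∑ i, ((σ' i : Fin n) : ℕ) = ∑ i, ((σ i : Fin n) : ℕ) := by
    rw [Equiv.sum_comp σ' (fun i : Fin n => (i : ℕ)), Equiv.sum_comp σ (fun i : Fin n => (i : ℕ))]
  have heq := (Finset.sum_eq_sum_iff_of_le (s := Finset.univ)
    (fun i _ => (Fin.le_def.mp (hle i)))).mp hsum
  have hσ : σ = σ' := by
    ext i
    exact (heq i (Finset.mem_univ i)).symm
  refine ⟨?_, hσ⟩
  funext i
  apply Units.ext
  rw [hdiag i, hσ, hUY.1, mul_one]

/-- The class `sgn(P) d₁ d₂ ⋯ dₙ` in the abelianization of the multiplicative group. -/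
noncomputable def bruhatClass (d : Fin n → Kˣ) (σ : Equiv.Perm (Fin n)) : Abelianization Kˣ :=
  Abelianization.of (Units.map (Int.castRingHom K : ℤ →* K) (Equiv.Perm.sign σ)) *
    ∏ i, Abelianization.of (d i)

/-- The Dieudonné determinant of a nonsingular matrix: `sgn(P) d₁ d₂ ⋯ dₙ` modulo commutators, for
the Bruhat normal form `L D P U` of the matrix. -/
noncomputable def Det (A : Matrix (Fin n) (Fin n) K) (hA : IsUnit A) : Abelianization Kˣ :=
  bruhatClass (exists_isBruhatForm A hA).choose_spec.choose
    (exists_isBruhatForm A hA).choose_spec.choose_spec.choose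

/-- The Dieudonné determinant can be read off from any Bruhat normal form. -/
theorem Det_eq {A L U : Matrix (Fin n) (Fin n) K} {d : Fin n → Kˣ} {σ : Equiv.Perm (Fin n)}
    (hA : IsUnit A) (h : IsBruhatForm A L d σ U) : Det A hA = bruhatClass d σ := by
  obtain ⟨h1, h2⟩ := IsBruhatForm.unique hA
    (exists_isBruhatForm A hA).choose_spec.choose_spec.choose_spec.choose_spec h
  exact congrArg₂ bruhatClass h1 h2

end Dieudonne

/-! ### The degree of the Dieudonné determinant and valuated matroids -/

section Valuated

variable {F : Type*} [DivisionRing F] {n m : ℕ}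

open scoped Classical in
/-- `deg Det A` for a square matrix over `F(t)`; it is `-∞` if `A` is singular. -/
noncomputable def degDet (A : Matrix (Fin n) (Fin n) (RationalFunction F)) : WithBot ℤ :=
  if hA : IsUnit A then (((degAb (Det A hA)).toAdd : ℤ) : WithBot ℤ) else ⊥

/-- The function `ω_A`: `deg Det A[X]` if `|X| = n`, where `A[X]` consists of the columns of `A` in
`X` (in their order), and `-∞` otherwise. -/
noncomputable def omega (A : Matrix (Fin n) (Fin m) (RationalFunction F)) (X : Finset (Fin m)) :
    WithBot ℝ :=
  if hX : X.card = n then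
    (degDet (A.submatrix id (X.orderEmbOfFin hX))).map (fun k : ℤ => (k : ℝ))
  else ⊥

/-- Valuated matroids on a finite set `E`, with values in `ℝ ∪ {-∞}`: the exchange axiom (EXC). -/
def IsValuatedMatroid {E : Type*} [DecidableEq E] (ω : Finset E → WithBot ℝ) : Prop :=
  ∀ X Y : Finset E, ω X ≠ ⊥ → ω Y ≠ ⊥ → ∀ e ∈ X \ Y, ∃ f ∈ Y \ X,
    ω X + ω Y ≤ ω ((X ∪ {f}) \ {e}) + ω ((Y ∪ {e}) \ {f})

end Valuated

end DegDet

/-! The argument is the skew version of the classical one through Cramer's rule. Let `B` and `C` be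
the nonsingular submatrices on the columns `X` and `Y`. Since `(B⁻¹ C)(C⁻¹ B) = 1`, the diagonal
entry belonging to `e ∈ X` writes `1` as a sum over `f ∈ Y` of products `(B⁻¹ A)_{e f} (C⁻¹ A)_{f
e}`. The degree of a sum is at most the maximal degree of its terms, so some product has degree at
least `0`. By Cramer's rule (`degDet_updateCol`), its first factor has degree `ω(X - e + f) - ω(X)`
and its second `ω(Y - f + e) - ω(Y)`; adding the two gives the exchange inequality.

Cramer's rule rests on the multiplicativity of the Dieudonné determinant (`HasDet.mul`): replacing a
column of `B` amounts to multiplying `B` on the right by an identity matrix with one column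
replaced. Multiplicativity is proved by tracking a Bruhat form under left multiplication by each
kind of factor in `L D P U`. Lower unitriangular factors are absorbed at once and diagonal ones
after a conjugation. The essential case is an adjacent transposition (`HasDet.adjacent_swap_mul`),
which comes down to an identity of 2 × 2 matrices. It yields all permutations, and upper
unitriangular factors are lower ones conjugated by the order-reversing permutation.

The relation `HasDet` lets these steps use whichever Bruhat form is convenient; uniqueness of the
form ties it to `Det`. -/

namespace DegDet

/-! ### Multiplicativity of the Dieudonné determinant -/

section Multiplicativity

variable {K : Type*} [DivisionRing K] {n : ℕ}

/-- `A` has a Bruhat normal form of class `x`. -/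
def HasDet (A : Matrix (Fin n) (Fin n) K) (x : Abelianization Kˣ) : Prop :=
  ∃ L d σ U, IsBruhatForm A L d σ U ∧ bruhatClass d σ = x

theorem HasDet.Det_eq {A : Matrix (Fin n) (Fin n) K} {x : Abelianization Kˣ} (h : HasDet A x)
    (hA : IsUnit A) : Det A hA = x := by
  obtain ⟨L, d, σ, U, h, rfl⟩ := h
  exact DegDet.Det_eq hA h

theorem exists_hasDet {A : Matrix (Fin n) (Fin n) K} (hA : IsUnit A) : ∃ x, HasDet A x := by
  obtain ⟨L, d, σ, U, h⟩ := exists_isBruhatForm A hA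
  exact ⟨_, L, d, σ, U, h, rfl⟩

/-! ### Unitriangular factors. -/

theorem isLowerUnitriangular_one : IsLowerUnitriangular (1 : Matrix (Fin n) (Fin n) K) :=
  ⟨fun _ => Matrix.one_apply_eq _, fun _ _ h => Matrix.one_apply_ne h.ne⟩

theorem isUpperUnitriangular_one : IsUpperUnitriangular (1 : Matrix (Fin n) (Fin n) K) :=
  ⟨fun _ => Matrix.one_apply_eq _, fun _ _ h => Matrix.one_apply_ne h.ne'⟩

theorem isLowerUnitriangular_one_add_single {i j : Fin n} (h : j < i) (c : K) :
    IsLowerUnitriangular (1 + Matrix.single i j c) := by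
  constructor
  · intro a
    rw [Matrix.add_apply, Matrix.one_apply_eq, Matrix.single_apply, if_neg, add_zero]
    rintro ⟨rfl, rfl⟩
    exact lt_irrefl _ h
  · intro a b hab
    rw [Matrix.add_apply, Matrix.one_apply_ne hab.ne, Matrix.single_apply, if_neg, add_zero]
    rintro ⟨rfl, rfl⟩
    exact lt_asymm h hab

theorem isUpperUnitriangular_one_add_single {i j : Fin n} (h : i < j) (c : K) :
    IsUpperUnitriangular (1 + Matrix.single i j c) := by
  constructor
  · intro a
    rw [Matrix.add_apply, Matrix.one_apply_eq, Matrix.single_apply, if_neg, add_zero]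
    rintro ⟨rfl, rfl⟩
    exact lt_irrefl _ h
  · intro a b hab
    rw [Matrix.add_apply, Matrix.one_apply_ne hab.ne', Matrix.single_apply, if_neg, add_zero]
    rintro ⟨rfl, rfl⟩
    exact lt_asymm h hab

theorem HasDet.lower_mul {A T : Matrix (Fin n) (Fin n) K} {x : Abelianization Kˣ}
    (h : HasDet A x) (hT : IsLowerUnitriangular T) : HasDet (T * A) x := by
  obtain ⟨L, d, σ, U, h, rfl⟩ := h
  refine ⟨T * L, d, σ, U, ⟨hT.mul h.lower, h.upper, ?_⟩, rfl⟩
  rw [h.eq]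
  simp only [Matrix.mul_assoc]

theorem HasDet.mul_upper {A T : Matrix (Fin n) (Fin n) K} {x : Abelianization Kˣ}
    (h : HasDet A x) (hT : IsUpperUnitriangular T) : HasDet (A * T) x := by
  obtain ⟨L, d, σ, U, h, rfl⟩ := h
  refine ⟨L, d, σ, U * T, ⟨h.lower, h.upper.mul hT, ?_⟩, rfl⟩
  rw [h.eq]
  simp only [Matrix.mul_assoc]

/-! ### Monomial matrices and the class of the sign. -/

theorem hasDet_diagonal_mul_permMatrix (d : Fin n → Kˣ) (σ : Equiv.Perm (Fin n)) :
    HasDet (Matrix.diagonal (fun i => (d i : K)) * σ.permMatrix K) (bruhatClass d σ) :=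
  ⟨1, d, σ, 1, ⟨isLowerUnitriangular_one, isUpperUnitriangular_one, by simp⟩, rfl⟩

theorem bruhatClass_mul (c d : Fin n → Kˣ) (σ : Equiv.Perm (Fin n)) :
    bruhatClass (c * d) σ = (∏ i, Abelianization.of (c i)) * bruhatClass d σ := by
  simp only [bruhatClass, Pi.mul_apply, map_mul, Finset.prod_mul_distrib]
  exact mul_left_comm _ _ _

/-- The class of the sign of a permutation. -/
noncomputable def signClass (K : Type*) [DivisionRing K] (σ : Equiv.Perm (Fin n)) :
    Abelianization Kˣ :=
  Abelianization.of (Units.map (Int.castRingHom K : ℤ →* K) (Equiv.Perm.sign σ))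

theorem signClass_mul (σ τ : Equiv.Perm (Fin n)) :
    signClass K (σ * τ) = signClass K σ * signClass K τ := by
  simp [signClass]

theorem signClass_one : signClass K (1 : Equiv.Perm (Fin n)) = 1 := by
  simp [signClass]

theorem signClass_mul_self (σ : Equiv.Perm (Fin n)) : signClass K σ * signClass K σ = 1 := by
  rw [signClass, ← map_mul, ← map_mul, ← sq, Int.units_sq, map_one, map_one]

theorem bruhatClass_comp (d : Fin n → Kˣ) (σ s : Equiv.Perm (Fin n)) :
    bruhatClass (d ∘ s) (σ * s) = signClass K s * bruhatClass d σ := by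
  simp only [bruhatClass, Function.comp_apply, signClass, map_mul,
    Equiv.prod_comp s fun i => Abelianization.of (d i)]
  rw [mul_comm (Abelianization.of _) (Abelianization.of _), mul_assoc]

theorem permMatrix_mul_monomial (d : Fin n → Kˣ) (σ s : Equiv.Perm (Fin n)) :
    s.permMatrix K * (Matrix.diagonal (fun i => (d i : K)) * σ.permMatrix K) =
      Matrix.diagonal (fun i => ((d ∘ s) i : K)) * (σ * s).permMatrix K := by
  ext a b
  rw [Equiv.Perm.permMatrix, PEquiv.toMatrix_toPEquiv_mul, Matrix.submatrix_apply, id,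
    diagonal_mul_permMatrix_apply, diagonal_mul_permMatrix_apply]
  rfl

/-- An elementary matrix can be moved to the right of a monomial one. Its position becomes `(σ i, σ
j)`, so whether it ends up upper unitriangular depends on the order of `σ i` and `σ j`, not on that
of `i` and `j`. -/
theorem one_add_single_mul_monomial (d : Fin n → Kˣ) (σ : Equiv.Perm (Fin n)) (i j : Fin n)
    (c : K) :
    (1 + Matrix.single i j c) * (Matrix.diagonal (fun i => (d i : K)) * σ.permMatrix K) =
      (Matrix.diagonal (fun i => (d i : K)) * σ.permMatrix K) *
        (1 + Matrix.single (σ i) (σ j) ((d i : K)⁻¹ * (c * d j))) := by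
  rw [add_mul, mul_add, one_mul, mul_one]
  congr 1
  ext a b
  by_cases ha : a = i
  · subst ha
    rw [Matrix.single_mul_apply_same, diagonal_mul_permMatrix_apply]
    by_cases hb : b = σ j
    · subst hb
      rw [Matrix.mul_single_apply_same, diagonal_mul_permMatrix_apply]
      simp
    · rw [Matrix.mul_single_apply_of_ne (hbj := hb), if_neg (Ne.symm hb), mul_zero]
  · rw [Matrix.single_mul_apply_of_ne (h := ha)]
    by_cases hb : b = σ j
    · subst hb
      rw [Matrix.mul_single_apply_same, diagonal_mul_permMatrix_apply,
        if_neg (fun h => ha (σ.injective h)), zero_mul]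
    · rw [Matrix.mul_single_apply_of_ne (hbj := hb)]

/-! ### Left multiplication by diagonal, permutation and upper unitriangular matrices. -/

theorem HasDet.diagonal_mul {A : Matrix (Fin n) (Fin n) K} {x : Abelianization Kˣ}
    (h : HasDet A x) (c : Fin n → Kˣ) :
    HasDet (Matrix.diagonal (fun i => (c i : K)) * A) ((∏ i, Abelianization.of (c i)) * x) := by
  obtain ⟨L, d, σ, U, h, rfl⟩ := h
  -- The diagonal matrix moves past `L` by conjugating it, which preserves lower unitriangularity,
  -- and then merges with `d`.
  refine ⟨Matrix.diagonal (fun i => (c i : K)) * L * Matrix.diagonal (fun i => ((c i)⁻¹ : K)),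
    c * d, σ, U, ⟨⟨?_, ?_⟩, h.upper, ?_⟩, bruhatClass_mul c d σ⟩
  · intro i
    simp [Matrix.diagonal_mul, Matrix.mul_diagonal, h.lower.1]
  · intro i j hij
    simp [Matrix.diagonal_mul, Matrix.mul_diagonal, h.lower.2 i j hij]
  · have e : Matrix.diagonal (fun i => ((c * d) i : K)) =
        Matrix.diagonal (fun i => (c i : K)) * Matrix.diagonal (fun i => (d i : K)) := by
      simp [Matrix.diagonal_mul_diagonal]
    have e' : Matrix.diagonal (fun i => ((c i)⁻¹ : K)) * Matrix.diagonal (fun i => (c i : K)) =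
        1 := by
      simp [Matrix.diagonal_mul_diagonal]
    rw [h.eq, e]
    simp only [Matrix.mul_assoc]
    rw [← Matrix.mul_assoc _ (Matrix.diagonal fun i => (c i : K)), e', Matrix.one_mul]

/-- Interchanging two adjacent rows, the lower of which has been increased by a multiple of the
upper one. -/
theorem swap_permMatrix_mul_one_add_single {i j : Fin n} (hij : i ≠ j) (c : Kˣ) :
    (Equiv.swap i j).permMatrix K * (1 + Matrix.single j i (c : K)) =
      (1 + Matrix.single j i (c : K)⁻¹) *
        (Matrix.diagonal (fun k => ((if k = i then c else if k = j then -c⁻¹ else 1 : Kˣ) : K)) *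
          (1 + Matrix.single i j (c : K)⁻¹)) := by
  ext a b
  rw [Equiv.Perm.permMatrix, PEquiv.toMatrix_toPEquiv_mul, Matrix.submatrix_apply, id,
    add_mul, one_mul, Matrix.add_apply (_ * _), Matrix.diagonal_mul]
  by_cases ha : a = i
  · subst ha
    rw [Matrix.single_mul_apply_of_ne (h := hij), Equiv.swap_apply_left]
    simp only [if_true, Matrix.add_apply, Matrix.one_apply, Matrix.single_apply, true_and]
    have hc := c.ne_zero
    by_cases hb : j = b
    · subst hb
      simp [hij, hc]
    · simp [hb]
  by_cases haj : a = j
  · subst haj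
    rw [Matrix.single_mul_apply_same, Matrix.diagonal_mul, Equiv.swap_apply_right]
    simp only [if_true, if_neg ha, Matrix.add_apply, Matrix.one_apply, Matrix.single_apply,
      true_and]
    have hc := c.ne_zero
    by_cases hb : b = i
    · subst hb
      simp [hij, hij.symm]
    · by_cases hb' : b = a
      · subst hb'
        simp [hij]
      · simp [Ne.symm hb, Ne.symm hb', hij]
  · rw [Matrix.single_mul_apply_of_ne (h := haj), Equiv.swap_apply_of_ne_of_ne ha haj]
    simp [ha, haj, Ne.symm ha, Ne.symm haj, Matrix.add_apply]

/-- Conjugation by an adjacent transposition spoils lower triangularity only through the entry `L j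
i`. That entry is split off as an elementary factor, which is then moved to the right through the
monomial part. If it would land below the diagonal there, the 2 × 2 identity first turns it into a
factor on the upper side. -/
theorem HasDet.adjacent_swap_mul {A : Matrix (Fin n) (Fin n) K} {x : Abelianization Kˣ}
    (h : HasDet A x) {i j : Fin n} (hij : (j : ℕ) = i + 1) :
    HasDet ((Equiv.swap i j).permMatrix K * A) (signClass K (Equiv.swap i j) * x) := by
  obtain ⟨L, d, σ, U, h, rfl⟩ := h
  have hlt : i < j := by rw [Fin.lt_def]; omega
  obtain ⟨s, hs⟩ : ∃ s, s = Equiv.swap i j := ⟨_, rfl⟩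
  obtain ⟨c, hc⟩ : ∃ c, c = L j i := ⟨_, rfl⟩
  -- A column operation clears the entry `(j, i)` of `L`, leaving `M`.
  obtain ⟨M, hM⟩ : ∃ M, M = L * (1 + Matrix.single j i (-c)) := ⟨_, rfl⟩
  have hMl : IsLowerUnitriangular M := by
    rw [hM]
    exact h.lower.mul (isLowerUnitriangular_one_add_single hlt _)
  have hMji : M j i = 0 := by
    rw [hM, mul_add, mul_one, Matrix.add_apply, Matrix.mul_single_apply_same, h.lower.1, one_mul,
      ← hc, add_neg_cancel]
  have hLM : L = M * (1 + Matrix.single j i c) := by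
    have e : (1 + Matrix.single j i (-c)) * (1 + Matrix.single j i c) = 1 := by
      rw [mul_add, mul_one, add_mul, one_mul, Matrix.single_mul_single_of_ne _ _ _ _ hlt.ne,
        add_zero, add_assoc, ← Matrix.single_add, neg_add_cancel, Matrix.single_zero, add_zero]
    rw [hM, Matrix.mul_assoc, e, Matrix.mul_one]
  have hss : s.permMatrix K * s.permMatrix K = 1 := by
    rw [← Matrix.permMatrix_mul, hs, Equiv.swap_mul_self, Matrix.permMatrix_one]
  have hN : IsLowerUnitriangular (s.permMatrix K * M * s.permMatrix K) := by
    have happ : ∀ a b, (s.permMatrix K * M * s.permMatrix K) a b = M (s a) (s b) := by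
      intro a b
      rw [Equiv.Perm.permMatrix, PEquiv.mul_toMatrix_toPEquiv, PEquiv.toMatrix_toPEquiv_mul,
        Matrix.submatrix_apply, Matrix.submatrix_apply, hs, Equiv.symm_swap]
      rfl
    refine ⟨fun a => by rw [happ, hMl.1], fun a b hab => ?_⟩
    rw [happ]
    by_cases hab' : a = i ∧ b = j
    · rw [hab'.1, hab'.2, hs, Equiv.swap_apply_left, Equiv.swap_apply_right, hMji]
    -- An adjacent transposition preserves the order of every pair of indices other than `i`, `j`.
    · apply hMl.2
      rw [hs, Equiv.swap_apply_def, Equiv.swap_apply_def]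
      simp only [Fin.lt_def, Fin.ext_iff] at *
      grind
  have main : HasDet (s.permMatrix K * (1 + Matrix.single j i c) *
      (Matrix.diagonal (fun i => (d i : K)) * σ.permMatrix K))
      (signClass K s * bruhatClass d σ) := by
    by_cases hc0 : c = 0
    · rw [hc0, Matrix.single_zero, add_zero, mul_one, permMatrix_mul_monomial, ← bruhatClass_comp]
      exact hasDet_diagonal_mul_permMatrix _ _
    rcases lt_or_gt_of_ne (σ.injective.ne hlt.ne) with hσ | hσ
    -- Here `σ i < σ j`: the upper factor of the 2 × 2 identity stays upper behind the monomial
    -- matrix.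
    · have e := swap_permMatrix_mul_one_add_single hlt.ne (Units.mk0 c hc0)
      rw [Units.val_mk0] at e
      rw [hs, e, Matrix.mul_assoc, Matrix.mul_assoc, one_add_single_mul_monomial]
      -- The diagonal factor contributes `c * (-c⁻¹) = -1`, the sign of the transposition.
      have hx : signClass K (Equiv.swap i j) = ∏ k, Abelianization.of
          (if k = i then Units.mk0 c hc0 else if k = j then -(Units.mk0 c hc0)⁻¹ else 1) := by
        rw [← Finset.mul_prod_erase _ _ (Finset.mem_univ i),
          ← Finset.mul_prod_erase _ _ (Finset.mem_erase.mpr ⟨hlt.ne', Finset.mem_univ j⟩),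
          Finset.prod_eq_one, mul_one, if_pos rfl, if_neg hlt.ne', if_pos rfl, ← map_mul,
          signClass, Equiv.Perm.sign_swap hlt.ne]
        · congr 1
          ext
          simp
        · intro k hk
          simp only [Finset.mem_erase] at hk
          rw [if_neg hk.2.1, if_neg hk.1, map_one]
      rw [hx]
      refine ((((hasDet_diagonal_mul_permMatrix d σ).mul_upper
        (isUpperUnitriangular_one_add_single hσ _)).diagonal_mul _)).lower_mul
        (isLowerUnitriangular_one_add_single hlt _)
    -- Here `σ j < σ i`, so the lower elementary factor itself becomes upper once moved to the
    -- right.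
    · rw [Matrix.mul_assoc, one_add_single_mul_monomial, ← Matrix.mul_assoc,
        permMatrix_mul_monomial, ← bruhatClass_comp]
      exact (hasDet_diagonal_mul_permMatrix _ _).mul_upper
        (isUpperUnitriangular_one_add_single hσ _)
  have key : s.permMatrix K * A = (s.permMatrix K * M * s.permMatrix K) *
      ((s.permMatrix K * (1 + Matrix.single j i c) *
        (Matrix.diagonal (fun i => (d i : K)) * σ.permMatrix K)) * U) := by
    simp only [Matrix.mul_assoc]
    rw [← Matrix.mul_assoc (s.permMatrix K) (s.permMatrix K), hss, Matrix.one_mul,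
      ← Matrix.mul_assoc M, ← hLM, h.eq]
    simp only [Matrix.mul_assoc]
  rw [← hs, key]
  exact (main.mul_upper h.upper).lower_mul hN

theorem HasDet.permMatrix_mul {A : Matrix (Fin n) (Fin n) K} {x : Abelianization Kˣ}
    (h : HasDet A x) (s : Equiv.Perm (Fin n)) :
    HasDet (s.permMatrix K * A) (signClass K s * x) := by
  rcases n with _ | n
  · obtain rfl := Subsingleton.elim s 1
    rwa [Matrix.permMatrix_one, one_mul, signClass_one, one_mul]
  have hs : s ∈ Submonoid.closure (Set.range fun i : Fin n => Equiv.swap i.castSucc i.succ) := by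
    rw [Equiv.Perm.mclosure_swap_castSucc_succ]
    trivial
  induction hs using Submonoid.closure_induction generalizing A x with
  | mem s hs =>
    obtain ⟨i, rfl⟩ := hs
    exact h.adjacent_swap_mul (by simp)
  | one => rwa [Matrix.permMatrix_one, one_mul, signClass_one, one_mul]
  | mul s t _ _ ihs iht =>
    -- `permMatrix` reverses products, so `s` acts on `A` first; the classes commute.
    rw [Matrix.permMatrix_mul, signClass_mul, Matrix.mul_assoc, mul_comm (signClass K s), mul_assoc]
    exact iht (ihs h)

/-- Conjugation by the order-reversing permutation `w` makes `T` lower unitriangular. The two outer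
copies of `w` contribute the square of a sign class, which is trivial. -/
theorem HasDet.upper_mul {A T : Matrix (Fin n) (Fin n) K} {x : Abelianization Kˣ}
    (h : HasDet A x) (hT : IsUpperUnitriangular T) : HasDet (T * A) x := by
  obtain ⟨w, hw⟩ : ∃ w : Equiv.Perm (Fin n), w = Fin.revPerm := ⟨_, rfl⟩
  have hww : w.permMatrix K * w.permMatrix K = 1 := by
    rw [← Matrix.permMatrix_mul, show w * w = 1 by ext; simp [hw], Matrix.permMatrix_one]
  have hL : IsLowerUnitriangular (w.permMatrix K * T * w.permMatrix K) := by
    have happ : ∀ a b, (w.permMatrix K * T * w.permMatrix K) a b = T a.rev b.rev := by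
      intro a b
      rw [Equiv.Perm.permMatrix, PEquiv.mul_toMatrix_toPEquiv, PEquiv.toMatrix_toPEquiv_mul,
        Matrix.submatrix_apply, Matrix.submatrix_apply, hw]
      rfl
    exact ⟨fun a => by rw [happ, hT.1],
      fun a b hab => by rw [happ, hT.2 _ _ (Fin.rev_lt_rev.mpr hab)]⟩
  have key : T * A = w.permMatrix K * ((w.permMatrix K * T * w.permMatrix K) *
      (w.permMatrix K * A)) := by
    simp only [Matrix.mul_assoc]
    rw [← Matrix.mul_assoc (w.permMatrix K) (w.permMatrix K) A, hww, Matrix.one_mul,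
      ← Matrix.mul_assoc (w.permMatrix K) (w.permMatrix K), hww, Matrix.one_mul]
  rw [key, ← one_mul x, ← signClass_mul_self w, mul_assoc (signClass K w)]
  exact ((h.permMatrix_mul w).lower_mul hL).permMatrix_mul w

/-- The Dieudonné determinant is multiplicative. -/
theorem HasDet.mul {A B : Matrix (Fin n) (Fin n) K} {x y : Abelianization Kˣ}
    (hA : HasDet A x) (hB : HasDet B y) : HasDet (A * B) (x * y) := by
  obtain ⟨L, d, σ, U, h, rfl⟩ := hA
  -- The factors of `A` are multiplied onto `B` one at a time, from the right; the class has to be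
  -- regrouped in the same order.
  rw [h.eq, bruhatClass, mul_comm (Abelianization.of _), mul_assoc (∏ i, _)]
  simp only [Matrix.mul_assoc]
  exact (((hB.upper_mul h.upper).permMatrix_mul σ).diagonal_mul d).lower_mul h.lower

theorem hasDet_permMatrix (s : Equiv.Perm (Fin n)) : HasDet (s.permMatrix K) (signClass K s) := by
  have h := hasDet_diagonal_mul_permMatrix (1 : Fin n → Kˣ) s
  simpa [bruhatClass, signClass] using h

/-- The determinant of an identity matrix with one column replaced. -/
theorem hasDet_updateCol_one (i : Fin n) (u : Fin n → K) (c : Kˣ) (hc : u i = c) :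
    HasDet ((1 : Matrix (Fin n) (Fin n) K).updateCol i u) (Abelianization.of c) := by
  -- The matrix needs no permutation: the entries of `u` above `i` go into `U`, the pivot `c` into
  -- `d`, and the entries below `i`, divided by the pivot on the right, into `L`.
  let d : Fin n → Kˣ := fun k => if k = i then c else 1
  let L : Matrix (Fin n) (Fin n) K :=
    (1 : Matrix (Fin n) (Fin n) K).updateCol i
      fun k => if k < i then 0 else if k = i then 1 else u k * (c : K)⁻¹
  let U : Matrix (Fin n) (Fin n) K :=
    (1 : Matrix (Fin n) (Fin n) K).updateCol i
      fun k => if k < i then u k else if k = i then 1 else 0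
  refine ⟨L, d, 1, U, ⟨⟨?_, ?_⟩, ⟨?_, ?_⟩, ?_⟩, ?_⟩
  · intro a
    simp only [L, Matrix.updateCol_apply, Matrix.one_apply]
    grind
  · intro a b hab
    simp only [L, Matrix.updateCol_apply, Matrix.one_apply]
    grind
  · intro a
    simp only [U, Matrix.updateCol_apply, Matrix.one_apply]
    grind
  · intro a b hab
    simp only [U, Matrix.updateCol_apply, Matrix.one_apply]
    grind
  · rw [Matrix.permMatrix_one, Matrix.mul_one]
    have hL : L = 1 + Matrix.of fun a b =>
        if b = i ∧ i < a then u a * (c : K)⁻¹ else 0 := by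
      ext a b
      simp only [L, Matrix.updateCol_apply, Matrix.one_apply, Matrix.add_apply, Matrix.of_apply]
      grind
    ext a b
    rw [hL, add_mul, add_mul, one_mul, Matrix.mul_assoc, Matrix.add_apply, Matrix.diagonal_mul,
      Matrix.mul_apply, Finset.sum_eq_single i, Matrix.diagonal_mul]
    · have hc0 := c.ne_zero
      simp only [U, d, Matrix.updateCol_apply, Matrix.one_apply, Matrix.of_apply]
      by_cases hb : b = i
      · subst hb
        rcases lt_trichotomy a b with h | rfl | h
        · simp [h, h.ne, h.not_gt]
        · simp [hc]
        · simp [h, h.ne', h.not_gt]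
      · have hb' := Ne.symm hb
        by_cases ha : a = i
        · subst ha; simp [hb, hb']
        · simp [ha, hb, hb']
    · intro k _ hk
      simp [hk]
    · simp
  · simp only [bruhatClass, d]
    rw [Finset.prod_eq_single i]
    · simp
    · intro k _ hk
      simp [hk]
    · simp

end Multiplicativity

/-! ### The degree of sums and of signs -/

section Degree

variable {F : Type*} [DivisionRing F]

theorem deg_oreDiv_le (p : Polynomial F) (q : nonZeroDivisors (Polynomial F)) :
    deg (OreLocalization.oreDiv p q) ≤
      (((p.natDegree : ℤ) - ((q : Polynomial F).natDegree : ℤ) : ℤ) : WithBot ℤ) := by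
  by_cases hp : p = 0
  · rw [hp, OreLocalization.zero_oreDiv, deg_zero]
    exact bot_le
  · exact (deg_oreDiv p q hp).le

/-- Over a common left denominator this is the bound for the degree of a sum of polynomials. The
numerators may cancel, hence the use of `deg_oreDiv_le`, which allows a zero numerator. -/
theorem deg_add_le (x y : RationalFunction F) : deg (x + y) ≤ max (deg x) (deg y) := by
  by_cases hx : x = 0
  · simp [hx]
  by_cases hy : y = 0
  · simp [hy]
  induction x using OreLocalization.ind with | _ p q
  induction y using OreLocalization.ind with | _ p' q'
  have hp : p ≠ 0 := by rintro rfl; simp at hx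
  have hp' : p' ≠ 0 := by rintro rfl; simp at hy
  have hq := nonZeroDivisors.coe_ne_zero q
  have hq' := nonZeroDivisors.coe_ne_zero q'
  obtain ⟨u, v, huv⟩ : ∃ (u : Polynomial F) (v : nonZeroDivisors (Polynomial F)),
      (v : Polynomial F) * (q : Polynomial F) = u * (q' : Polynomial F) :=
    ⟨_, _, OreLocalization.ore_eq (q : Polynomial F) q'⟩
  have hv := nonZeroDivisors.coe_ne_zero v
  have hu : u ≠ 0 := by
    rintro rfl
    rw [zero_mul] at huv
    exact (mul_ne_zero hv hq) huv
  rw [OreLocalization.oreDiv_add_char q q' u v huv]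
  refine (deg_oreDiv_le _ _).trans ?_
  rw [deg_oreDiv _ _ hp, deg_oreDiv _ _ hp']
  have h1 := Polynomial.natDegree_add_le ((v : Polynomial F) * p) (u * p')
  have h2 := congrArg Polynomial.natDegree huv
  rw [Polynomial.natDegree_mul hv hp, Polynomial.natDegree_mul hu hp'] at h1
  rw [Polynomial.natDegree_mul hv hq, Polynomial.natDegree_mul hu hq'] at h2
  have h3 : (((v * q : nonZeroDivisors (Polynomial F)) : Polynomial F)).natDegree =
      (v : Polynomial F).natDegree + (q : Polynomial F).natDegree := by
    rw [Submonoid.coe_mul, Polynomial.natDegree_mul hv hq]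
  rw [h3, ← WithBot.coe_max, WithBot.coe_le_coe, smul_eq_mul]
  change (((v : Polynomial F) * p + u * p').natDegree : ℤ) - _ ≤ _
  push_cast
  omega

theorem exists_zero_le_deg_of_sum_eq_one {ι : Type*} (s : Finset ι) (g : ι → RationalFunction F)
    (h : ∑ i ∈ s, g i = 1) : ∃ i ∈ s, 0 ≤ deg (g i) := by
  classical
  by_contra! hcon
  -- Every partial sum has negative degree, starting from the empty one of degree `-∞`; the full sum
  -- `1` has degree `0`.
  have : ∀ t ⊆ s, deg (∑ i ∈ t, g i) < 0 := by
    intro t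
    induction t using Finset.induction_on with
    | empty => intro _; simp [deg_zero]
    | insert a t ha ih =>
      intro hts
      rw [Finset.sum_insert ha]
      exact (deg_add_le _ _).trans_lt (max_lt (hcon a (hts (Finset.mem_insert_self a t)))
        (ih ((Finset.subset_insert a t).trans hts)))
  have h1 := this s subset_rfl
  rw [h, deg_one] at h1
  exact lt_irrefl _ h1

theorem coe_degAb_of (u : (RationalFunction F)ˣ) :
    (((degAb (Abelianization.of u)).toAdd : ℤ) : WithBot ℤ) = deg (u : RationalFunction F) := by
  rw [degAb, Abelianization.lift_apply_of]
  simp [degHom]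

/-- A sign class squares to `1`, and `ℤ` has no torsion. -/
theorem degAb_signClass {n : ℕ} (s : Equiv.Perm (Fin n)) :
    degAb (signClass (RationalFunction F) s) = 1 := by
  have h := congrArg degAb (signClass_mul_self (K := RationalFunction F) s)
  rw [map_mul, map_one] at h
  have h' : (degAb (signClass (RationalFunction F) s)).toAdd +
      (degAb (signClass (RationalFunction F) s)).toAdd = 0 := by
    rw [← toAdd_mul, h, toAdd_one]
  rw [← toAdd_eq_zero]
  omega

end Degree

/-! ### Exchange of columns -/

section Exchange

variable {F : Type*} [DivisionRing F] {n m : ℕ}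

theorem HasDet.degDet_eq {A : Matrix (Fin n) (Fin n) (RationalFunction F)}
    {x : Abelianization (RationalFunction F)ˣ} (h : HasDet A x) (hA : IsUnit A) :
    degDet A = (((degAb x).toAdd : ℤ) : WithBot ℤ) := by
  rw [degDet, dif_pos hA, h.Det_eq hA]

theorem isUnit_of_degDet_ne_bot {A : Matrix (Fin n) (Fin n) (RationalFunction F)}
    (h : degDet A ≠ ⊥) : IsUnit A := by
  by_contra hA
  exact h (by rw [degDet, dif_neg hA])

theorem isUnit_updateCol_one {K : Type*} [DivisionRing K] (i : Fin n) (u : Fin n → K)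
    (hu : u i ≠ 0) : IsUnit ((1 : Matrix (Fin n) (Fin n) K).updateCol i u) := by
  have h : (1 : Matrix (Fin n) (Fin n) K).updateCol i u *
      (1 : Matrix (Fin n) (Fin n) K).updateCol i
        (fun k => if k = i then (u i)⁻¹ else -(u k * (u i)⁻¹)) = 1 := by
    ext a b
    rw [Matrix.mul_apply, ← Finset.add_sum_erase _ _ (Finset.mem_univ i), Matrix.updateCol_self,
      Finset.sum_congr rfl fun k hk => by rw [Matrix.updateCol_ne (Finset.ne_of_mem_erase hk)]]
    simp only [Matrix.one_apply, ite_mul, one_mul, zero_mul, Finset.sum_ite_eq,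
      Finset.mem_erase, Finset.mem_univ, and_true, Matrix.updateCol_apply]
    by_cases ha : a = i <;> by_cases hb : b = i <;> simp_all [eq_comm]
  exact isUnit_iff_exists.mpr ⟨_, h, mul_eq_one_symm h⟩

theorem degDet_mul {A B : Matrix (Fin n) (Fin n) (RationalFunction F)} (hA : IsUnit A)
    (hB : IsUnit B) : degDet (A * B) = degDet A + degDet B := by
  obtain ⟨x, hx⟩ := exists_hasDet hA
  obtain ⟨y, hy⟩ := exists_hasDet hB
  rw [(hx.mul hy).degDet_eq (hA.mul hB), hx.degDet_eq hA, hy.degDet_eq hB, ← WithBot.coe_add,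
    map_mul, toAdd_mul]

theorem isUnit_permMatrix {K : Type*} [DivisionRing K] (s : Equiv.Perm (Fin n)) :
    IsUnit (s.permMatrix K) := by
  refine isUnit_iff_exists.mpr ⟨(s⁻¹).permMatrix K, ?_, ?_⟩ <;>
    rw [← Matrix.permMatrix_mul] <;> simp

theorem degDet_submatrix_perm (A : Matrix (Fin n) (Fin n) (RationalFunction F))
    (s : Equiv.Perm (Fin n)) : degDet (A.submatrix id s) = degDet A := by
  have e : A.submatrix id s = A * (s⁻¹).permMatrix (RationalFunction F) := by
    rw [Equiv.Perm.permMatrix, PEquiv.mul_toMatrix_toPEquiv]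
    rfl
  have hs := isUnit_permMatrix (K := RationalFunction F) s⁻¹
  rw [e]
  by_cases hA : IsUnit A
  · rw [degDet_mul hA hs, (hasDet_permMatrix _).degDet_eq hs, degAb_signClass]
    simp
  -- If `A` is singular, so is the permuted matrix, and both degrees are `-∞`.
  · rw [degDet, degDet, dif_neg hA, dif_neg]
    rwa [hs.mul_right_iff]

/-- The function `ω_A` can be computed from any enumeration of the columns. -/
theorem omega_eq (A : Matrix (Fin n) (Fin m) (RationalFunction F)) (X : Finset (Fin m))
    (g : Fin n → Fin m) (hg : Function.Injective g) (hX : X = Finset.univ.image g) :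
    omega A X = (degDet (A.submatrix id g)).map (fun k : ℤ => (k : ℝ)) := by
  have hcard : X.card = n := by
    rw [hX, Finset.card_image_of_injective _ hg, Finset.card_univ, Fintype.card_fin]
  rw [omega, dif_pos hcard]
  have hmem : ∀ i, ∃ k, X.orderEmbOfFin hcard k = g i := by
    intro i
    have : g i ∈ Set.range (X.orderEmbOfFin hcard) := by
      rw [Finset.range_orderEmbOfFin, hX]
      simp
    exact this
  choose s hs using hmem
  have hinj : Function.Injective s := fun a b hab => hg (by rw [← hs, ← hs, hab])
  let σ : Equiv.Perm (Fin n) := Equiv.ofBijective s (Finite.injective_iff_bijective.mp hinj)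
  have e : A.submatrix id g = (A.submatrix id (X.orderEmbOfFin hcard)).submatrix id σ := by
    ext a b
    simp only [Matrix.submatrix_apply, id]
    rw [← hs b]
    rfl
  rw [e, degDet_submatrix_perm]

/-- This is Cramer's rule in degrees. The new matrix is `B` times an identity matrix whose column
`i` is `B⁻¹ a`, and the determinant of that factor is its pivot. -/
theorem degDet_updateCol {B C : Matrix (Fin n) (Fin n) (RationalFunction F)} (hBC : B * C = 1)
    (i : Fin n) (a : Fin n → RationalFunction F) (ha : C.mulVec a i ≠ 0) :
    degDet (B.updateCol i a) = degDet B + deg (C.mulVec a i) := by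
  have hB : IsUnit B := isUnit_iff_exists.mpr ⟨C, hBC, mul_eq_one_symm hBC⟩
  have e : B.updateCol i a =
      B * (1 : Matrix (Fin n) (Fin n) (RationalFunction F)).updateCol i (C.mulVec a) := by
    ext k l
    by_cases hl : l = i
    · subst hl
      have h := congrFun (Matrix.mulVec_mulVec a B C) k
      rw [hBC, Matrix.one_mulVec] at h
      rw [Matrix.updateCol_self, ← h, Matrix.mulVec, dotProduct, Matrix.mul_apply]
      simp
    · rw [Matrix.updateCol_ne hl, Matrix.mul_apply]
      simp [Matrix.updateCol_ne hl, Matrix.one_apply]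
  have h1 := hasDet_updateCol_one i (C.mulVec a) (Units.mk0 _ ha) rfl
  have hu : IsUnit ((1 : Matrix (Fin n) (Fin n) (RationalFunction F)).updateCol i
      (C.mulVec a)) := isUnit_updateCol_one i _ ha
  rw [e, degDet_mul hB hu, h1.degDet_eq hu, coe_degAb_of, Units.val_mk0]

/-- The exchanged set is enumerated by putting `f` in the place of `g i`, so that its submatrix
differs from the old one in column `i` alone. This enumeration need not be increasing, which is why
`omega_eq` is needed. -/
theorem omega_exchange (A : Matrix (Fin n) (Fin m) (RationalFunction F)) (g : Fin n → Fin m)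
    (hg : Function.Injective g) {C : Matrix (Fin n) (Fin n) (RationalFunction F)}
    (hC : A.submatrix id g * C = 1) (i : Fin n) (f : Fin m) (hf : f ∉ Finset.univ.image g)
    (h0 : (C * A) i f ≠ 0) :
    omega A ((Finset.univ.image g ∪ {f}) \ {g i}) =
      (degDet (A.submatrix id g) + deg ((C * A) i f)).map (fun k : ℤ => (k : ℝ)) := by
  have hf' : ∀ k, g k ≠ f := by simpa using hf
  rw [omega_eq A _ (Function.update g i f)]
  · refine congrArg _ (Eq.trans ?_ (degDet_updateCol hC i (fun k => A k f) h0))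
    congr 1
    ext a b
    by_cases hb : b = i
    · subst hb
      simp
    · simp [hb]
  · intro a b hab
    have := hf' a
    have := hf' b
    have := @hg a b
    simp only [Function.update_apply] at hab
    grind
  · ext x
    simp only [Finset.mem_sdiff, Finset.mem_union, Finset.mem_image, Finset.mem_univ, true_and,
      Finset.mem_singleton, Function.update_apply]
    constructor
    · rintro ⟨⟨k, rfl⟩ | rfl, h⟩
      · exact ⟨k, if_neg fun hk => h (by rw [hk])⟩
      · exact ⟨i, if_pos rfl⟩
    · rintro ⟨k, hk⟩
      split_ifs at hk with hki
      · subst hk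
        exact ⟨Or.inr rfl, (hf' i).symm⟩
      · subst hk
        exact ⟨Or.inl ⟨k, rfl⟩, fun h => hki (hg h)⟩

theorem exists_basis_of_omega_ne_bot {A : Matrix (Fin n) (Fin m) (RationalFunction F)}
    {X : Finset (Fin m)} (h : omega A X ≠ ⊥) : ∃ g : Fin n → Fin m, Function.Injective g ∧
      X = Finset.univ.image g ∧ IsUnit (A.submatrix id g) := by
  by_cases hX : X.card = n
  · refine ⟨X.orderEmbOfFin hX, (X.orderEmbOfFin hX).injective, ?_, ?_⟩
    · rw [← Finset.coe_inj, Finset.coe_image, Finset.coe_univ, Set.image_univ,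
        Finset.range_orderEmbOfFin]
    · apply isUnit_of_degDet_ne_bot
      intro h'
      rw [omega, dif_pos hX, h'] at h
      exact h rfl
  · rw [omega, dif_neg hX] at h
    exact absurd rfl h

end Exchange

end DegDet

/-! ### The exchange axiom. -/

theorem proposition2p7 {F : Type*} [DivisionRing F] (n m : ℕ)
    (A : Matrix (Fin n) (Fin m) (DegDet.RationalFunction F)) :
    DegDet.IsValuatedMatroid (DegDet.omega A) := by
  intro X Y hX hY e he
  obtain ⟨g, hg, rfl, hB⟩ := DegDet.exists_basis_of_omega_ne_bot hX
  obtain ⟨h, hh, rfl, hC⟩ := DegDet.exists_basis_of_omega_ne_bot hY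
  obtain ⟨B', hB1, hB2⟩ := isUnit_iff_exists.mp hB
  obtain ⟨C', hC1, hC2⟩ := isUnit_iff_exists.mp hC
  rw [Finset.mem_sdiff] at he
  obtain ⟨heX, heY⟩ := he
  obtain ⟨i, -, rfl⟩ := Finset.mem_image.mp heX
  -- The diagonal entry at `i` of `(B⁻¹ C)(C⁻¹ B) = 1`, where `B` and `C` are the submatrices on `X`
  -- and `Y`.
  have hsum : ∑ j, (B' * A) i (h j) * (C' * A) j (g i) = 1 := by
    calc ∑ j, (B' * A) i (h j) * (C' * A) j (g i)
        = ((B' * A.submatrix id h) * (C' * A.submatrix id g)) i i := rfl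
      _ = 1 := by
        rw [Matrix.mul_assoc, ← Matrix.mul_assoc (A.submatrix id h), hC1, Matrix.one_mul, hB2,
          Matrix.one_apply_eq]
  obtain ⟨j, -, hj⟩ := DegDet.exists_zero_le_deg_of_sum_eq_one _ _ hsum
  have hne : (B' * A) i (h j) * (C' * A) j (g i) ≠ 0 := by
    intro h0
    rw [h0, DegDet.deg_zero] at hj
    exact absurd hj (by simp)
  -- If `h j` were the column `g k` of `X`, the first factor would be the entry `(i, k)` of the
  -- identity. It vanishes because `g i ∉ Y` forces `k ≠ i`.
  have hfX : h j ∉ Finset.univ.image g := by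
    intro hmem
    obtain ⟨k, -, hk⟩ := Finset.mem_image.mp hmem
    have h1 : (B' * A) i (h j) = (1 : Matrix (Fin n) (Fin n) (DegDet.RationalFunction F)) i k := by
      rw [← hk, ← hB2]
      rfl
    have hik : i ≠ k := by
      rintro rfl
      exact heY (by rw [hk]; simp)
    exact left_ne_zero_of_mul hne (by rw [h1, Matrix.one_apply_ne hik])
  refine ⟨h j, Finset.mem_sdiff.mpr ⟨by simp, hfX⟩, ?_⟩
  rw [DegDet.omega_exchange A g hg hB1 i (h j) hfX (left_ne_zero_of_mul hne),
    DegDet.omega_exchange A h hh hC1 j (g i) heY (right_ne_zero_of_mul hne),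
    DegDet.omega_eq A _ g hg rfl, DegDet.omega_eq A _ h hh rfl]
  rw [DegDet.deg_mul] at hj
  -- The cast from `ℤ` to `ℝ` is additive and monotone, so the inequality can be checked over `ℤ ∪
  -- {-∞}`.
  have hadd : ∀ a b : WithBot ℤ, a.map (fun k : ℤ => (k : ℝ)) + b.map (fun k : ℤ => (k : ℝ)) =
      (a + b).map (fun k : ℤ => (k : ℝ)) :=
    fun a b => (WithBot.map_add (Int.castAddHom ℝ) a b).symm
  have hmono : Monotone (WithBot.map (fun k : ℤ => (k : ℝ))) :=
    WithBot.monotone_map_iff.mpr Int.cast_mono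
  rw [hadd, hadd, add_add_add_comm]
  exact hmono (le_add_of_nonneg_right hj)
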